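/- **Setting.** Let $(W,S)$ be a finite Coxeter system of rank $r=|S|$, let $\ell$ be its Coxeter length (the least number of elements of $S$ in a word for the given element), and for $I\subseteq S$ let $W_I$ be the subgroup generated by $I$, with longest element $w_0(W_I)$. For $w\in W$ let $d(w)=\#\{s\in S:\ell(sw)<\ell(w)\}$ be the number of left descents, and for $0\le x\le r$ let $\mathsf{maxw}_0(W,x)=\max\{\ell(w_0(W_I)) : I\subseteq S,\ |I|=x\}$. The element $w$ is *proper* if $\ell(w)\le r+\mathsf{maxw}_0(W,d(w))$. Let $S_n$ be the symmetric group with the simple generators $(i\ \,i{+}1)$, $1\le i<n$ (type $A_{n-1}$, rank $n-1$). Let $S_n^B$ be the group of bijections $w$ of $\{-n,\dots,-1,1,\dots,n\}$ with $w(-i)=-w(i)$ for all $i$, with the simple generators $s_0=(1\ \,{-1})$ and $s_i=(i\ \,i{+}1)(-i\ \,{-(i{+}1)})$, $1\le i<n$ (type $B_n$, rank $n$). For $n\ge 2$ let $S_n^D\subseteq S_n^B$ be the subgroup of those $w$ for which $\#\{i\in\{1,\dots,n\}: w(i)<0\}$ is even, with the simple generators $s_0^D=(1\ \,{-2})(-1\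 \,2)$ and $s_1,\dots,s_{n-1}$ as above (type $D_n$, rank $n$). **Theorem 6.2.** There is an absolute constant $c>0$ such that each of the following holds: for every $n\ge 1$ the number of proper elements of $S_n$ is at least $(cn)^n$; for every $n\ge 2$ the number of proper elements of $S_n^D$ is at least $(cn)^n$; and for every $n\ge 1$ the number of proper elements of $S_n^B$ is at least $(cn)^n$. -/

import Mathlib

/-! ### Length, descents and proper elements for a group with a family of generators

In this section `W` is a group and `s : ι → W` lists its simple generators without repetition,
so that `Fintype.card ι` is the rank. The notions below depend only on the pair `(W, s)`; they are
meant for, and only applied to, finite Coxeter systems. -/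

namespace ProperElements

section General

variable {ι W : Type*} [Group W]

/-- The Coxeter length: the least number of simple generators in a word with product `w`. -/
noncomputable def length (s : ι → W) (w : W) : ℕ :=
  sInf {k : ℕ | ∃ l : List ι, l.length = k ∧ (l.map s).prod = w}

/-- The standard parabolic subgroup `W_I` generated by the `s i` with `i ∈ I`. -/
def parabolic (s : ι → W) (I : Finset ι) : Subgroup W :=
  Subgroup.closure (s '' (I : Set ι))

/-- The maximal length of an element of `W_I`, i.e. the length of its longest element `w₀(W_I)`. -/
noncomputable def longestLength (s : ι → W) (I : Finset ι) : ℕ :=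
  sSup {k : ℕ | ∃ w ∈ parabolic s I, length s w = k}

variable [Fintype ι]

/-- The set `J(w)` of left descents of `w`. -/
noncomputable def leftDescents (s : ι → W) (w : W) : Finset ι :=
  Finset.univ.filter fun j => length s (s j * w) < length s w

/-- `maxw₀(W, x)`: the maximum of `ℓ(w₀(W_I))` over all sets `I` of exactly `x` simple
generators. -/
noncomputable def maxw0 (s : ι → W) (x : ℕ) : ℕ :=
  (Finset.univ.powersetCard x).sup (longestLength s)

/-- `w` is proper if `ℓ(w) ≤ rank + maxw₀(W, d(w))`, where `d(w)` is the number of left descents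
of `w`. -/
def IsProper (s : ι → W) (w : W) : Prop :=
  length s w ≤ Fintype.card ι + maxw0 s (leftDescents s w).card

end General

/-! ### Type A -/

/-- The adjacent transpositions of the symmetric group `S_n` on `Fin n`, which is the Coxeter group
of type `A_{n-1}`. -/
def simpleA (n : ℕ) (i : Fin (n - 1)) : Equiv.Perm (Fin n) :=
  Equiv.swap ⟨i, by omega⟩ ⟨i + 1, by omega⟩

/-! ### Type B: signed permutations -/

/-- The set `[±n] = {-n, …, -1, 1, …, n}`. -/
def PM (n : ℕ) : Type := {k : ℤ // k ≠ 0 ∧ |k| ≤ n}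

instance (n : ℕ) : DecidableEq (PM n) :=
  inferInstanceAs (DecidableEq {k : ℤ // k ≠ 0 ∧ |k| ≤ n})

namespace PM

variable {n : ℕ}

instance : Neg (PM n) := ⟨fun k => ⟨-k.1, neg_ne_zero.2 k.2.1, by rw [abs_neg]; exact k.2.2⟩⟩

@[simp] theorem val_neg (k : PM n) : (-k).1 = -k.1 := rfl

@[ext] theorem ext {k l : PM n} (h : k.1 = l.1) : k = l := Subtype.ext h

instance : InvolutiveNeg (PM n) where
  neg_neg k := by ext; simp

theorem neg_ne_self (k : PM n) : -k ≠ k := fun h => by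
  have h1 := congrArg Subtype.val h
  have h2 := k.2.1
  simp only [val_neg] at h1
  omega

/-- The positive element `i + 1` of `[±n]`, for `i = 0, …, n - 1`. -/
def pos (i : Fin n) : PM n :=
  ⟨(i : ℤ) + 1, by omega, by rw [abs_of_nonneg (by omega)]; omega⟩

@[simp] theorem val_pos (i : Fin n) : (pos i).1 = (i : ℤ) + 1 := rfl

theorem pos_injective : Function.Injective (pos : Fin n → PM n) := fun i j h => by
  have := congrArg Subtype.val h
  simp only [val_pos] at this
  omega

theorem pos_ne_neg_pos (i j : Fin n) : pos i ≠ -pos j := fun h => by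
  have := congrArg Subtype.val h
  simp only [val_pos, val_neg] at this
  omega

/-- The index `i` with `k = pos i` or `k = -pos i`. -/
def idx (k : PM n) : Fin n :=
  ⟨k.1.natAbs - 1, by
    obtain ⟨h0, h1⟩ := k.2
    rw [abs_le] at h1
    omega⟩

theorem eq_pos_or_neg (k : PM n) : (0 < k.1 ∧ k = pos k.idx) ∨ (k.1 < 0 ∧ k = -pos k.idx) := by
  obtain ⟨k, h0, h⟩ := k
  rcases lt_or_gt_of_ne h0 with h1 | h1
  · right
    refine ⟨h1, ?_⟩
    ext
    simp only [val_neg, val_pos, idx]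
    omega
  · left
    refine ⟨h1, ?_⟩
    ext
    simp only [val_pos, idx]
    omega

end PM

/-- The group `S_n^B` of signed permutations: the bijections `w` of `[±n]` with `w (-k) = -w k` for
all `k`, under composition. -/
def SB (n : ℕ) : Subgroup (Equiv.Perm (PM n)) where
  carrier := {w | ∀ k, w (-k) = -w k}
  one_mem' := fun _ => rfl
  mul_mem' := fun {v w} hv hw k => by
    rw [Equiv.Perm.mul_apply, Equiv.Perm.mul_apply, hw, hv]
  inv_mem' := fun {w} hw k => by
    rw [Equiv.Perm.inv_eq_iff_eq, hw, ← Equiv.Perm.mul_apply, mul_inv_cancel, Equiv.Perm.one_apply]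

/-- The involution that exchanges `k` with `-k` and fixes everything else. -/
def negSwap {n : ℕ} (k : PM n) : SB n :=
  ⟨Equiv.swap k (-k), fun l => by
    by_cases h1 : l = k
    · subst h1; simp
    by_cases h2 : l = -k
    · subst h2; simp
    have h3 : -l ≠ k := fun h => h2 (by rw [← h, neg_neg])
    have h4 : -l ≠ -k := fun h => h1 (neg_injective h)
    rw [Equiv.swap_apply_of_ne_of_ne h3 h4, Equiv.swap_apply_of_ne_of_ne h1 h2]⟩

/-- For `l ≠ k` and `l ≠ -k`, the involution that exchanges `k` with `l` and `-k` with `-l` and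
fixes everything else. -/
def pairSwap {n : ℕ} (k l : PM n) (h : l ≠ k) (h' : l ≠ -k) : SB n :=
  ⟨Equiv.swap k l * Equiv.swap (-k) (-l), fun m => by
    have e1 := PM.neg_ne_self k
    have e2 := PM.neg_ne_self l
    have e3 : k ≠ -l := fun e => h' (by rw [e, neg_neg])
    have e4 : -l ≠ -k := fun e => h (neg_injective e)
    simp only [Equiv.Perm.mul_apply]
    by_cases h1 : m = k
    · subst h1
      rw [Equiv.swap_apply_left, Equiv.swap_apply_of_ne_of_ne e3.symm e2,
        Equiv.swap_apply_of_ne_of_ne e1.symm e3, Equiv.swap_apply_left]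
    by_cases h2 : m = l
    · subst h2
      rw [Equiv.swap_apply_right, Equiv.swap_apply_of_ne_of_ne e1 h'.symm,
        Equiv.swap_apply_of_ne_of_ne h' e2.symm, Equiv.swap_apply_right]
    by_cases h3 : m = -k
    · subst h3
      rw [neg_neg, Equiv.swap_apply_of_ne_of_ne e1.symm e3, Equiv.swap_apply_left,
        Equiv.swap_apply_left, Equiv.swap_apply_of_ne_of_ne e3.symm e2, neg_neg]
    by_cases h4 : m = -l
    · subst h4
      rw [neg_neg, Equiv.swap_apply_of_ne_of_ne h' e2.symm, Equiv.swap_apply_right,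
        Equiv.swap_apply_right, Equiv.swap_apply_of_ne_of_ne e1 h'.symm, neg_neg]
    have h5 : -m ≠ k := fun e => h3 (by rw [← e, neg_neg])
    have h6 : -m ≠ l := fun e => h4 (by rw [← e, neg_neg])
    have h7 : -m ≠ -k := fun e => h1 (neg_injective e)
    have h8 : -m ≠ -l := fun e => h2 (neg_injective e)
    rw [Equiv.swap_apply_of_ne_of_ne h7 h8, Equiv.swap_apply_of_ne_of_ne h5 h6,
      Equiv.swap_apply_of_ne_of_ne h3 h4, Equiv.swap_apply_of_ne_of_ne h1 h2]⟩

/-- For `1 ≤ i < n`, the generator `s_i`, which exchanges `i` with `i + 1` and `-i` with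
`-(i + 1)`. It belongs to the types B and D. -/
def adjacentSwap {n : ℕ} (i : Fin n) (hi : (i : ℕ) ≠ 0) : SB n :=
  pairSwap (PM.pos ⟨(i : ℕ) - 1, by omega⟩) (PM.pos i)
    (fun h => by
      have := congrArg Subtype.val h
      simp only [PM.val_pos] at this
      omega)
    (fun h => by
      have := congrArg Subtype.val h
      simp only [PM.val_pos, PM.val_neg] at this
      omega)

/-- The simple generators `s_0, …, s_{n-1}` of `S_n^B`, the Coxeter group of type `B_n`: `s_0`
exchanges `1` with `-1`. -/
def simpleB (n : ℕ) (i : Fin n) : SB n :=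
  if hi : (i : ℕ) = 0 then negSwap (PM.pos i) else adjacentSwap i hi

/-! ### Type D: even signed permutations -/

/-- `neg(w)`: the number of `i ∈ {1, …, n}` with `w(i) < 0`. -/
def negCount {n : ℕ} (w : SB n) : ℕ :=
  (Finset.univ.filter fun i : Fin n => (w.1 (PM.pos i)).1 < 0).card

/-- The parity of `neg(w)` as a sign. -/
theorem neg_one_pow_negCount {n : ℕ} (w : SB n) :
    (-1 : ℤ) ^ negCount w = ∏ i : Fin n, (w.1 (PM.pos i)).1.sign := by
  rw [negCount, ← Finset.prod_const, Finset.prod_filter]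
  refine Finset.prod_congr rfl fun i _ => ?_
  have h := (w.1 (PM.pos i)).2.1
  split_ifs with h1
  · rw [Int.sign_eq_neg_one_of_neg h1]
  · rw [Int.sign_eq_one_of_pos (by omega)]

theorem neg_one_pow_negCount_mul {n : ℕ} (v w : SB n) :
    (-1 : ℤ) ^ negCount (v * w) = (-1) ^ negCount v * (-1) ^ negCount w := by
  have hinj : Function.Injective fun i : Fin n => (w.1 (PM.pos i)).idx := by
    intro i j hij
    have key : w.1 (PM.pos i) = w.1 (PM.pos j) ∨ w.1 (PM.pos i) = -w.1 (PM.pos j) := by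
      simp only at hij
      rcases PM.eq_pos_or_neg (w.1 (PM.pos i)) with ⟨-, h1⟩ | ⟨-, h1⟩ <;>
      rcases PM.eq_pos_or_neg (w.1 (PM.pos j)) with ⟨-, h2⟩ | ⟨-, h2⟩ <;>
      rw [h1, h2, hij] <;> simp
    rcases key with h | h
    · have h1 := congrArg Subtype.val (w.1.injective h)
      simp only [PM.val_pos] at h1
      omega
    · rw [← w.2] at h
      have h1 := congrArg Subtype.val (w.1.injective h)
      simp only [PM.val_pos, PM.val_neg] at h1
      omega
  have hbij : Function.Bijective fun i : Fin n => (w.1 (PM.pos i)).idx :=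
    Finite.injective_iff_bijective.1 hinj
  rw [neg_one_pow_negCount, neg_one_pow_negCount, neg_one_pow_negCount,
    ← hbij.prod_comp fun i => (v.1 (PM.pos i)).1.sign, ← Finset.prod_mul_distrib]
  refine Finset.prod_congr rfl fun i _ => ?_
  have e : ((v * w).1 (PM.pos i)) = v.1 (w.1 (PM.pos i)) := rfl
  rw [e]
  rcases PM.eq_pos_or_neg (w.1 (PM.pos i)) with ⟨h1, h2⟩ | ⟨h1, h2⟩
  · rw [Int.sign_eq_one_of_pos h1, mul_one, ← h2]
  · rw [Int.sign_eq_neg_one_of_neg h1]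
    conv_lhs => rw [h2]
    rw [v.2, PM.val_neg, Int.sign_neg, mul_neg_one]

theorem even_negCount_iff {n : ℕ} (w : SB n) : Even (negCount w) ↔ (-1 : ℤ) ^ negCount w = 1 :=
  (neg_one_pow_eq_one_iff_even (by norm_num)).symm

theorem negCount_one (n : ℕ) : negCount (1 : SB n) = 0 := by
  rw [negCount, Finset.card_eq_zero, Finset.filter_eq_empty_iff]
  intro i _
  have e : ((1 : SB n).1 (PM.pos i)).1 = (i : ℤ) + 1 := rfl
  rw [e]
  omega

/-- The group `S_n^D` of the signed permutations `w` with `neg(w)` even. -/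
def SD (n : ℕ) : Subgroup (SB n) where
  carrier := {w | Even (negCount w)}
  one_mem' := by simp [negCount_one]
  mul_mem' := fun {v w} hv hw => by
    have hv' := (even_negCount_iff v).1 hv
    have hw' := (even_negCount_iff w).1 hw
    exact (even_negCount_iff _).2 (by rw [neg_one_pow_negCount_mul, hv', hw', mul_one])
  inv_mem' := fun {w} hw => by
    have hw' := (even_negCount_iff w).1 hw
    have h := neg_one_pow_negCount_mul w w⁻¹
    rw [mul_inv_cancel, negCount_one, hw', one_mul, pow_zero] at h
    exact (even_negCount_iff _).2 h.symm

theorem adjacentSwap_mem_SD {n : ℕ} (i : Fin n) (hi : (i : ℕ) ≠ 0) :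
    adjacentSwap i hi ∈ SD n := by
  have h : negCount (adjacentSwap i hi) = 0 := by
    rw [negCount, Finset.card_eq_zero, Finset.filter_eq_empty_iff]
    intro j _
    have e : (adjacentSwap i hi).1 (PM.pos j) =
        Equiv.swap (PM.pos ⟨(i : ℕ) - 1, by omega⟩) (PM.pos i)
          (Equiv.swap (-PM.pos ⟨(i : ℕ) - 1, by omega⟩) (-PM.pos i) (PM.pos j)) := rfl
    rw [e, Equiv.swap_apply_of_ne_of_ne (PM.pos_ne_neg_pos _ _) (PM.pos_ne_neg_pos _ _),
      Equiv.swap_apply_def]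
    split_ifs <;> rw [PM.val_pos] <;> omega
  change Even _
  rw [h]
  exact Even.zero

/-- The generator `s_0` of type D, which exchanges `1` with `-2` and `-1` with `2`. -/
def twistedSwap (n : ℕ) (hn : 2 ≤ n) : SB n :=
  pairSwap (PM.pos ⟨0, by omega⟩) (-PM.pos ⟨1, by omega⟩)
    (fun h => by
      have := congrArg Subtype.val h
      simp [PM.val_pos, PM.val_neg] at this)
    (fun h => by
      have := congrArg Subtype.val h
      simp [PM.val_pos, PM.val_neg] at this)

theorem twistedSwap_mem_SD (n : ℕ) (hn : 2 ≤ n) : twistedSwap n hn ∈ SD n := by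
  have h : negCount (twistedSwap n hn) = 2 := by
    have e : ∀ j, (twistedSwap n hn).1 (PM.pos j) =
        Equiv.swap (PM.pos ⟨0, by omega⟩) (-PM.pos ⟨1, by omega⟩)
          (Equiv.swap (-PM.pos ⟨0, by omega⟩) (- -PM.pos ⟨1, by omega⟩) (PM.pos j)) :=
      fun _ => rfl
    have hs : (Finset.univ.filter fun j : Fin n =>
        ((twistedSwap n hn).1 (PM.pos j)).1 < 0) = {⟨0, by omega⟩, ⟨1, by omega⟩} := by
      ext j
      rw [Finset.mem_filter, Finset.mem_insert, Finset.mem_singleton, e, neg_neg]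
      simp only [Finset.mem_univ, true_and]
      by_cases h1 : j = ⟨1, by omega⟩
      · subst h1
        rw [Equiv.swap_apply_right, Equiv.swap_apply_of_ne_of_ne (PM.pos_ne_neg_pos _ _).symm]
        · simp
        · intro h
          have := congrArg Subtype.val h
          simp at this
      · have h2 : PM.pos j ≠ PM.pos ⟨1, by omega⟩ := fun h => h1 (PM.pos_injective h)
        rw [Equiv.swap_apply_of_ne_of_ne (PM.pos_ne_neg_pos _ _) h2]
        by_cases h3 : j = ⟨0, by omega⟩
        · subst h3
          rw [Equiv.swap_apply_left]
          simp
        · have h4 : PM.pos j ≠ PM.pos ⟨0, by omega⟩ := fun h => h3 (PM.pos_injective h)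
          rw [Equiv.swap_apply_of_ne_of_ne h4 (PM.pos_ne_neg_pos _ _)]
          simp only [h1, h3, or_self, iff_false, PM.val_pos]
          omega
    rw [negCount, hs, Finset.card_pair (by simp)]
  change Even _
  rw [h]
  exact even_two

/-- The simple generators `s_0, …, s_{n-1}` of `S_n^D`, the Coxeter group of type `D_n`. -/
def simpleD (n : ℕ) (hn : 2 ≤ n) (i : Fin n) : SD n :=
  if hi : (i : ℕ) = 0 then ⟨twistedSwap n hn, twistedSwap_mem_SD n hn⟩
  else ⟨adjacentSwap i hi, adjacentSwap_mem_SD i hi⟩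

end ProperElements

namespace ProperElements

/-! ### Words, lengths and standard parabolic subgroups -/

section Words

variable {ι W : Type*} [Group W] (s : ι → W)

/-! The heart is type A, where length counts inversions. Cut the `n` points into at most 32 blocks
of consecutive points, of size `n / 32 + 1`, and look at the permutations preserving every block.
They number at least `n! / 32 ^ n`, and each has at most `n * (n / 32)` inversions, since an
inversion stays inside a block.

Such a `w` is proper once it has `d ≥ n / 4` left descents: a parabolic subgroup on `d` consecutive
generators is a copy of `S_{d+1}`, whose longest element has length `d(d+1)/2 ≥ n²/32`. To obtain
many descents, pair `w` with `w * R`, where `R` reverses every block. A generator whose two points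
share a block is a left descent of `w` or of `w * R`, so for `n ≥ 66` one of the two has enough
descents (`card_blockPerms_le`). Hence at least half as many elements are proper as preserve the
blocks, and `n! ≥ (n/3)^n` finishes type A.

Types B and D contain `S_n` as a standard parabolic subgroup, and forgetting signs retracts onto it,
sending each simple generator to a simple generator or to 1. Along such a retraction proper elements
stay proper (`IsProper.map_of_retraction`), so the type A count is a lower bound. -/

theorem length_prod_le (l : List ι) : length s (l.map s).prod ≤ l.length :=
  Nat.sInf_le ⟨l, rfl, rfl⟩

theorem exists_reduced_word {w : W} (h : ∃ l : List ι, (l.map s).prod = w) :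
    ∃ l : List ι, l.length = length s w ∧ (l.map s).prod = w := by
  obtain ⟨l, hl⟩ := h
  exact Nat.sInf_mem (s := {k : ℕ | ∃ l : List ι, l.length = k ∧ (l.map s).prod = w})
    ⟨l.length, l, rfl, hl⟩

theorem length_one : length s (1 : W) = 0 :=
  Nat.le_zero.1 (length_prod_le s [])

theorem isProper_one [Fintype ι] : IsProper s (1 : W) := by
  rw [IsProper, length_one]
  exact Nat.zero_le _

theorem bddAbove_lengths [Finite W] (I : Finset ι) :
    BddAbove {k : ℕ | ∃ w ∈ parabolic s I, length s w = k} :=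
  ((Set.finite_range (length s)).subset (by rintro _ ⟨w, -, rfl⟩; exact ⟨w, rfl⟩)).bddAbove

theorem length_le_longestLength [Finite W] {I : Finset ι} {w : W} (hw : w ∈ parabolic s I) :
    length s w ≤ longestLength s I :=
  le_csSup (bddAbove_lengths s I) ⟨w, hw, rfl⟩

theorem exists_length_eq_longestLength [Finite W] (I : Finset ι) :
    ∃ w ∈ parabolic s I, length s w = longestLength s I :=
  Nat.sSup_mem (s := {k : ℕ | ∃ w ∈ parabolic s I, length s w = k})
    ⟨_, 1, Subgroup.one_mem _, rfl⟩ (bddAbove_lengths s I)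

theorem longestLength_mono [Finite W] {I J : Finset ι} (h : I ⊆ J) :
    longestLength s I ≤ longestLength s J := by
  obtain ⟨w, hw, hl⟩ := exists_length_eq_longestLength s I
  rw [← hl]
  exact length_le_longestLength s
    (Subgroup.closure_mono (Set.image_mono (by exact_mod_cast h)) hw)

theorem length_le_maxw0 [Finite W] [Fintype ι] {I : Finset ι} {w : W} (hw : w ∈ parabolic s I) :
    length s w ≤ maxw0 s I.card :=
  (length_le_longestLength s hw).trans
    (Finset.le_sup (f := longestLength s) (Finset.mem_powersetCard.2 ⟨Finset.subset_univ _, rfl⟩))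

/-- Every `x`-set extends to a `y`-set. Beyond the rank there are no `y`-sets, and the supremum
drops to 0. -/
theorem maxw0_mono [Finite W] [Fintype ι] {x y : ℕ} (hxy : x ≤ y) (hy : y ≤ Fintype.card ι) :
    maxw0 s x ≤ maxw0 s y := by
  refine Finset.sup_le fun I hI => ?_
  have hI' := (Finset.mem_powersetCard.1 hI).2
  obtain ⟨J, hIJ, -, hJ⟩ := Finset.exists_subsuperset_card_eq (Finset.subset_univ I)
    (hI'.le.trans hxy) (by rwa [Finset.card_univ])
  exact (longestLength_mono s hIJ).trans
    (Finset.le_sup (f := longestLength s) (Finset.mem_powersetCard.2 ⟨Finset.subset_univ _, hJ⟩))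

/-! ### Transfer along a retraction -/

variable {κ V : Type*} [Group V] (t : κ → V) {s} {t}

/-- `φ` carries words to words of the same length, and `π` carries words to words that are no
longer, because each generator becomes a generator or disappears. -/
theorem length_map_of_retraction {e : κ → ι} {φ : V →* W} {π : W →* V}
    (hφ : ∀ i, φ (t i) = s (e i)) (hπ : ∀ j, π (s j) = 1 ∨ ∃ i, π (s j) = t i)
    (hπφ : ∀ v, π (φ v) = v) (hgen : ∀ v, ∃ l : List κ, (l.map t).prod = v) (v : V) :
    length s (φ v) = length t v := by
  obtain ⟨l, hl, rfl⟩ := exists_reduced_word t (hgen v)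
  have hword : ((l.map e).map s).prod = φ (l.map t).prod := by
    rw [map_list_prod, List.map_map, List.map_map]
    congr 1
    exact List.map_congr_left fun i _ => (hφ i).symm
  apply le_antisymm
  · rw [← hword, ← hl]
    simpa using length_prod_le s (l.map e)
  · obtain ⟨l', hl', h⟩ := exists_reduced_word s ⟨_, hword⟩
    have key : ∀ l' : List ι, ∃ l'' : List κ, l''.length ≤ l'.length ∧
        (l''.map t).prod = π (l'.map s).prod := by
      intro l'
      induction l' with
      | nil => exact ⟨[], by simp⟩
      | cons j l' ih =>
        obtain ⟨l'', h1, h2⟩ := ih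
        rcases hπ j with h | ⟨i, h⟩
        · exact ⟨l'', by simp; omega, by simp [h, h2]⟩
        · exact ⟨i :: l'', by simpa using h1, by simp [h, h2]⟩
    obtain ⟨l'', h1, h2⟩ := key l'
    rw [h, hπφ] at h2
    rw [← hl', ← h2]
    exact (length_prod_le t l'').trans h1

/-- The length of the element is unchanged, while rank, number of descents and `maxw0` can only
grow. -/
theorem IsProper.map_of_retraction [Finite V] [Finite W] [Fintype κ] [Fintype ι] {e : κ → ι}
    (he : Function.Injective e) {φ : V →* W} {π : W →* V}
    (hφ : ∀ i, φ (t i) = s (e i)) (hπ : ∀ j, π (s j) = 1 ∨ ∃ i, π (s j) = t i)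
    (hπφ : ∀ v, π (φ v) = v) (hgen : ∀ v, ∃ l : List κ, (l.map t).prod = v) {v : V}
    (hv : IsProper t v) : IsProper s (φ v) := by
  classical
  have hlen := length_map_of_retraction hφ hπ hπφ hgen
  have hmax : ∀ x, maxw0 t x ≤ maxw0 s x := by
    intro x
    refine Finset.sup_le fun I hI => ?_
    obtain ⟨u, hu, hl⟩ := exists_length_eq_longestLength t I
    rw [← hl, ← hlen, ← (Finset.mem_powersetCard.1 hI).2, ← Finset.card_image_of_injective I he]
    refine length_le_maxw0 s ?_
    have : (parabolic t I).map φ ≤ parabolic s (I.image e) := by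
      rw [parabolic, MonoidHom.map_closure, parabolic, ← Set.image_comp, Finset.coe_image,
        ← Set.image_comp]
      exact le_of_eq (congrArg _ (Set.image_congr fun i _ => hφ i))
    exact this ⟨u, hu, rfl⟩
  have hdesc : (leftDescents t v).card ≤ (leftDescents s (φ v)).card := by
    rw [← Finset.card_image_of_injective _ he]
    refine Finset.card_le_card fun j hj => ?_
    obtain ⟨i, hi, rfl⟩ := Finset.mem_image.1 hj
    rw [leftDescents, Finset.mem_filter] at hi ⊢
    rw [← hφ, ← map_mul, hlen, hlen]
    exact ⟨Finset.mem_univ _, hi.2⟩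
  have h1 := maxw0_mono s hdesc (Finset.card_le_univ _)
  have h2 := hmax (leftDescents t v).card
  have h3 := Fintype.card_le_of_injective e he
  rw [IsProper] at hv ⊢
  rw [hlen]
  omega

theorem card_isProper_le_of_retraction [Finite V] [Finite W] [Fintype κ] [Fintype ι] {e : κ → ι}
    (he : Function.Injective e) {φ : V →* W} {π : W →* V}
    (hφ : ∀ i, φ (t i) = s (e i)) (hπ : ∀ j, π (s j) = 1 ∨ ∃ i, π (s j) = t i)
    (hπφ : ∀ v, π (φ v) = v) (hgen : ∀ v, ∃ l : List κ, (l.map t).prod = v) :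
    Nat.card {v : V // IsProper t v} ≤ Nat.card {w : W // IsProper s w} :=
  Nat.card_le_card_of_injective
    (fun v => ⟨φ v.1, v.2.map_of_retraction he hφ hπ hπφ hgen⟩) fun v v' h => by
      have := congrArg (fun w => π w.1) h
      simp only [hπφ] at this
      exact Subtype.ext this

end Words

/-! ### Inversions of a permutation -/

section Inversions

variable {n : ℕ}

/-- The inversions of `w`, as pairs of positions. -/
def inversions (w : Equiv.Perm (Fin n)) : Finset (Fin n × Fin n) :=
  Finset.univ.filter fun p => p.1 < p.2 ∧ w p.2 < w p.1

theorem simpleA_mul_self (i : Fin (n - 1)) : simpleA n i * simpleA n i = 1 :=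
  Equiv.swap_mul_self _ _

/-- The lower of the two points moved by `simpleA n i`. -/
def lo (i : Fin (n - 1)) : Fin n := ⟨i, by omega⟩

/-- The upper of the two points moved by `simpleA n i`. -/
def hi (i : Fin (n - 1)) : Fin n := ⟨i + 1, by omega⟩

theorem simpleA_eq_swap (i : Fin (n - 1)) : simpleA n i = Equiv.swap (lo i) (hi i) := rfl

/-- Left multiplication exchanges two consecutive values, so only the pair of positions holding them
changes its relative order. -/
theorem inversions_simpleA_mul {w : Equiv.Perm (Fin n)} {i : Fin (n - 1)}
    (h : w.symm (lo i) < w.symm (hi i)) :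
    inversions (simpleA n i * w) = insert (w.symm (lo i), w.symm (hi i)) (inversions w) := by
  ext ⟨a, b⟩
  have key : ∀ c, simpleA n i (w c) = if c = w.symm (lo i) then hi i else
      if c = w.symm (hi i) then lo i else w c := by
    intro c
    rw [simpleA_eq_swap, Equiv.swap_apply_def]
    simp only [Equiv.eq_symm_apply]
  simp only [inversions, Finset.mem_filter, Finset.mem_insert, Finset.mem_univ, true_and,
    Prod.mk.injEq, Equiv.Perm.mul_apply, key]
  -- No third position holds the value `i` or `i + 1`, and no value lies between them; the case
  -- split below needs only this.
  have ha : ∀ c, c ≠ w.symm (lo i) → (w c : ℕ) ≠ i := fun c hc e =>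
    hc (by rw [Equiv.eq_symm_apply]; exact Fin.ext e)
  have hb : ∀ c, c ≠ w.symm (hi i) → (w c : ℕ) ≠ i + 1 := fun c hc e =>
    hc (by rw [Equiv.eq_symm_apply]; exact Fin.ext e)
  have e1 : (w (w.symm (lo i)) : ℕ) = i := by rw [Equiv.apply_symm_apply]; rfl
  have e2 : (w (w.symm (hi i)) : ℕ) = i + 1 := by rw [Equiv.apply_symm_apply]; rfl
  have e3 : ((lo i : Fin n) : ℕ) = i := rfl
  have e4 : ((hi i : Fin n) : ℕ) = i + 1 := rfl
  have ha1 := ha a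
  have ha2 := ha b
  have hb1 := hb a
  have hb2 := hb b
  generalize w.symm (lo i) = p at *
  generalize w.symm (hi i) = q at *
  by_cases c1 : a = p <;> by_cases c2 : a = q <;> by_cases c3 : b = p <;> by_cases c4 : b = q <;>
    simp only [c1, c2, c3, c4, if_true, if_false, Fin.lt_def, Fin.ext_iff] at * <;> grind

theorem card_inversions_simpleA_mul_of_lt {w : Equiv.Perm (Fin n)} {i : Fin (n - 1)}
    (h : w.symm (lo i) < w.symm (hi i)) :
    (inversions (simpleA n i * w)).card = (inversions w).card + 1 := by
  rw [inversions_simpleA_mul h, Finset.card_insert_of_notMem]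
  intro h1
  have h2 := (Finset.mem_filter.1 h1).2.2
  simp only [Equiv.apply_symm_apply, lo, hi, Fin.lt_def] at h2
  omega

theorem card_inversions_simpleA_mul_of_gt {w : Equiv.Perm (Fin n)} {i : Fin (n - 1)}
    (h : w.symm (hi i) < w.symm (lo i)) :
    (inversions (simpleA n i * w)).card + 1 = (inversions w).card := by
  have h' : (simpleA n i * w).symm (lo i) < (simpleA n i * w).symm (hi i) := by
    have e1 : (simpleA n i * w).symm (lo i) = w.symm (hi i) := by
      simp [Equiv.symm_apply_eq, simpleA_eq_swap]
    have e2 : (simpleA n i * w).symm (hi i) = w.symm (lo i) := by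
      simp [Equiv.symm_apply_eq, simpleA_eq_swap]
    rwa [e1, e2]
  have := card_inversions_simpleA_mul_of_lt h'
  rw [← mul_assoc, simpleA_mul_self, one_mul] at this
  exact this.symm

theorem symm_lo_ne_symm_hi (w : Equiv.Perm (Fin n)) (i : Fin (n - 1)) :
    w.symm (lo i) ≠ w.symm (hi i) := fun h => by
  have := congrArg Fin.val (w.symm.injective h)
  simp [lo, hi] at this

theorem card_inversions_one : (inversions (1 : Equiv.Perm (Fin n))).card = 0 := by
  rw [Finset.card_eq_zero, inversions, Finset.filter_eq_empty_iff]
  rintro p - ⟨h1, h2⟩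
  exact lt_asymm h1 h2

theorem card_inversions_prod_le (l : List (Fin (n - 1))) :
    (inversions (l.map (simpleA n)).prod).card ≤ l.length := by
  induction l with
  | nil => simp [card_inversions_one]
  | cons i l ih =>
    rw [List.map_cons, List.prod_cons, List.length_cons]
    rcases lt_or_gt_of_ne (symm_lo_ne_symm_hi (l.map (simpleA n)).prod i) with h | h
    · rw [card_inversions_simpleA_mul_of_lt h]; omega
    · have := card_inversions_simpleA_mul_of_gt h; omega

/-- Otherwise `w.symm` is strictly increasing, and the identity is the only order automorphism of
`Fin n`. -/
theorem exists_symm_hi_lt_symm_lo {w : Equiv.Perm (Fin n)} (hw : w ≠ 1) :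
    ∃ i : Fin (n - 1), w.symm (hi i) < w.symm (lo i) := by
  by_contra! hcon
  apply hw
  rcases n with _ | n
  · exact Subsingleton.elim _ _
  have hmono : StrictMono w.symm := by
    rw [Fin.strictMono_iff_lt_succ]
    intro i
    exact lt_of_le_of_ne (hcon i) (symm_lo_ne_symm_hi w i)
  have h1 : w.symm = Equiv.refl _ := by
    have := Subsingleton.elim (hmono.orderIsoOfSurjective _ w.symm.surjective) (OrderIso.refl _)
    ext a
    exact congrArg (fun f : Fin (n + 1) ≃o Fin (n + 1) => (f a : ℕ)) this
  ext a
  have := congrArg (fun f => f (w a)) h1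
  simp only [Equiv.symm_apply_apply, Equiv.refl_apply] at this
  rw [← this]; rfl

/-- A permutation fixing all points above `x` has a word of length its number of inversions in the
first `x` generators. -/
theorem exists_word_of_fixes (x : ℕ) (w : Equiv.Perm (Fin n)) (hw : ∀ a : Fin n, x < a → w a = a) :
    ∃ l : List (Fin (n - 1)), (∀ i ∈ l, (i : ℕ) < x) ∧ l.length = (inversions w).card ∧
      (l.map (simpleA n)).prod = w := by
  induction hk : (inversions w).card generalizing w with
  | zero =>
    by_cases h1 : w = 1
    · exact ⟨[], by simp, by simp, by simp [h1]⟩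
    · obtain ⟨i, hi⟩ := exists_symm_hi_lt_symm_lo h1
      have := card_inversions_simpleA_mul_of_gt hi
      omega
  | succ k ih =>
    have h1 : w ≠ 1 := by
      rintro rfl
      rw [card_inversions_one] at hk
      omega
    obtain ⟨i, hi'⟩ := exists_symm_hi_lt_symm_lo h1
    have hc := card_inversions_simpleA_mul_of_gt hi'
    -- If `x ≤ i`, then `hi i` is fixed, so the preimage of `lo i` lies above it, hence above `x`.
    -- That preimage is then fixed as well and equals `lo i`, which is not above `hi i`.
    have hix : (i : ℕ) < x := by
      by_contra! hx
      have e1 : w.symm (hi i) = hi i := by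
        rw [Equiv.symm_apply_eq, hw]
        simp only [hi]; omega
      rw [e1] at hi'
      have h2 : x < (w.symm (lo i) : ℕ) := by
        have : (hi i : Fin n).val < (w.symm (lo i)).val := hi'
        simp only [hi] at this
        omega
      have h3 := hw _ h2
      rw [Equiv.apply_symm_apply] at h3
      rw [← h3] at hi'
      simp [hi, lo, Fin.lt_def] at hi'
    obtain ⟨l, hl1, hl2, hl3⟩ := ih (simpleA n i * w) (fun a ha => by
      rw [Equiv.Perm.mul_apply, hw a ha, simpleA_eq_swap, Equiv.swap_apply_of_ne_of_ne] <;>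
      · rw [Ne, Fin.ext_iff]
        simp only [hi, lo]
        omega) (by omega)
    refine ⟨i :: l, ?_, by simp [hl2], ?_⟩
    · simpa [hix] using hl1
    · rw [List.map_cons, List.prod_cons, hl3, ← mul_assoc, simpleA_mul_self, one_mul]

theorem simpleA_generates (w : Equiv.Perm (Fin n)) :
    ∃ l : List (Fin (n - 1)), (l.map (simpleA n)).prod = w := by
  obtain ⟨l, -, -, h⟩ := exists_word_of_fixes n w fun a ha => by omega
  exact ⟨l, h⟩

theorem length_simpleA (w : Equiv.Perm (Fin n)) :
    length (simpleA n) w = (inversions w).card := by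
  apply le_antisymm
  · obtain ⟨l, -, h1, h⟩ := exists_word_of_fixes n w fun a ha => by omega
    rw [← h1]
    conv_lhs => rw [← h]
    exact length_prod_le _ l
  · obtain ⟨l, h1, h2⟩ := exists_reduced_word _ (simpleA_generates w)
    rw [← h1]
    conv_lhs => rw [← h2]
    exact card_inversions_prod_le l

theorem mem_leftDescents_simpleA {w : Equiv.Perm (Fin n)} {i : Fin (n - 1)} :
    i ∈ leftDescents (simpleA n) w ↔ w.symm (hi i) < w.symm (lo i) := by
  rw [leftDescents, Finset.mem_filter, length_simpleA, length_simpleA]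
  rcases lt_or_gt_of_ne (symm_lo_ne_symm_hi w i) with h | h
  · have h1 := card_inversions_simpleA_mul_of_lt h
    have h2 := lt_asymm h
    simp only [h2, iff_false, Finset.mem_univ, true_and]
    omega
  · have h1 := card_inversions_simpleA_mul_of_gt h
    simp only [h, iff_true, Finset.mem_univ, true_and]
    omega

/-- The permutation reversing the first `x + 1` points. -/
def reversePrefix (n x : ℕ) (hx : x < n) : Equiv.Perm (Fin n) :=
  Function.Involutive.toPerm (fun a => if (a : ℕ) ≤ x then ⟨x - a, by omega⟩ else a) fun a => by
    by_cases h : (a : ℕ) ≤ x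
    · simp only [h, if_true, Nat.sub_le, Fin.ext_iff]
      omega
    · simp only [h, if_false]

theorem reversePrefix_apply {x : ℕ} (hx : x < n) (a : Fin n) :
    reversePrefix n x hx a = if (a : ℕ) ≤ x then ⟨x - a, by omega⟩ else a := rfl

theorem le_card_inversions_reversePrefix {x : ℕ} (hx : x < n) :
    (x + 1) * x / 2 ≤ (inversions (reversePrefix n x hx)).card := by
  -- The triangular number counts pairs `a < b ≤ x`, all of which the reversal inverts.
  have h0 : (x + 1) * x / 2 = ((Finset.range (x + 1)).sigma fun b => Finset.range b).card := by
    rw [Finset.card_sigma]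
    simp only [Finset.card_range]
    rw [Finset.sum_range_id]
    simp
  rw [h0]
  refine Finset.card_le_card_of_injOn
    (fun p => if h : p.1 < n ∧ p.2 < n then (⟨p.2, h.2⟩, ⟨p.1, h.1⟩) else (⟨x, hx⟩, ⟨x, hx⟩)) ?_ ?_
  · rintro ⟨b, a⟩ h
    simp only [Finset.coe_sigma, Set.mem_sigma_iff, Finset.coe_range, Set.mem_Iio] at h
    have h' : b < n ∧ a < n := by omega
    simp only [h', and_self, dite_true, inversions, Finset.coe_filter, Finset.mem_univ, true_and,
      Set.mem_ofPred_eq, reversePrefix_apply, Fin.lt_def]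
    rw [if_pos (by omega), if_pos (by omega)]
    simp only
    omega
  · rintro ⟨b, a⟩ h ⟨b', a'⟩ h1 h2
    simp only [Finset.coe_sigma, Set.mem_sigma_iff, Finset.coe_range, Set.mem_Iio] at h h1
    have h' : b < n ∧ a < n := by omega
    have h1' : b' < n ∧ a' < n := by omega
    simp only [h', h1', and_self, dite_true, Prod.mk.injEq, Fin.mk.injEq] at h2
    obtain ⟨rfl, rfl⟩ := h2
    rfl

/-- The reversal of the first `x + 1` points lies in the parabolic subgroup of the first `x`
generators. -/
theorem le_maxw0_simpleA {x : ℕ} (hx : x < n) : (x + 1) * x / 2 ≤ maxw0 (simpleA n) x := by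
  let I : Finset (Fin (n - 1)) := Finset.univ.filter fun i => (i : ℕ) < x
  have hI : I.card = x := by
    simp only [I]
    rw [Fin.card_filter_val_lt]
    omega
  obtain ⟨l, h1, -, h3⟩ := exists_word_of_fixes x (reversePrefix n x hx) fun a ha => by
    rw [reversePrefix_apply, if_neg (by omega)]
  have hmem : reversePrefix n x hx ∈ parabolic (simpleA n) I := by
    rw [← h3]
    refine Subgroup.list_prod_mem _ fun g hg => ?_
    obtain ⟨i, hi, rfl⟩ := List.mem_map.1 hg
    exact Subgroup.subset_closure ⟨i, by simpa [I] using h1 i hi, rfl⟩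
  refine (le_card_inversions_reversePrefix hx).trans ?_
  rw [← length_simpleA]
  conv_rhs => rw [← hI]
  exact length_le_maxw0 _ hmem

end Inversions

/-! ### Permutations preserving consecutive blocks -/

section Blocks

variable {n : ℕ}

/-- The permutations preserving each block of `m` consecutive points. -/
def blockPerms (n m : ℕ) : Finset (Equiv.Perm (Fin n)) :=
  Finset.univ.filter fun w => ∀ a : Fin n, (w a : ℕ) / m = a / m

theorem mem_blockPerms {m : ℕ} {w : Equiv.Perm (Fin n)} :
    w ∈ blockPerms n m ↔ ∀ a : Fin n, (w a : ℕ) / m = a / m := by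
  simp [blockPerms]

theorem symm_apply_div {m : ℕ} {w : Equiv.Perm (Fin n)} (hw : w ∈ blockPerms n m) (a : Fin n) :
    (w.symm a : ℕ) / m = a / m := by
  have := mem_blockPerms.1 hw (w.symm a)
  rwa [Equiv.apply_symm_apply, eq_comm] at this

/-- The number of block-preserving permutations is at least `n! / k ^ n` if there are at most `k`
blocks. -/
theorem factorial_le_card_blockPerms_mul {m k : ℕ} (hm : n ≤ k * m) :
    n.factorial ≤ (blockPerms n m).card * k ^ n := by
  classical
  have hlt : ∀ a : Fin n, (a : ℕ) / m < k := fun a =>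
    Nat.div_lt_of_lt_mul (by rw [mul_comm]; omega)
  -- `F w` records the block of each value. Two permutations with the same record differ by a
  -- block-preserving left factor, and there are at most `k ^ n` records.
  let F : Equiv.Perm (Fin n) → Fin n → Fin k := fun w a => ⟨(w a : ℕ) / m, hlt _⟩
  have h := Finset.card_le_mul_card_image (f := F) Finset.univ (blockPerms n m).card (by
    intro g hg
    obtain ⟨w₀, -, rfl⟩ := Finset.mem_image.1 hg
    refine Finset.card_le_card_of_injOn (fun w => w * w₀⁻¹) ?_
      ((mul_left_injective w₀⁻¹).injOn)
    intro w hw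
    have hw' : F w = F w₀ := by simpa using hw
    refine mem_blockPerms.2 fun a => ?_
    have := congrArg Fin.val (congrFun hw' (w₀⁻¹ a))
    simpa [F] using this)
  rw [Finset.card_univ, Fintype.card_perm, Fintype.card_fin] at h
  refine h.trans (Nat.mul_le_mul_left _ ((Finset.card_le_univ _).trans ?_))
  simp

/-- The positions `a < b` of an inversion share a block of size at most `m + 1`, so the pair is
determined by `a` and the gap `b - a - 1 < m`. -/
theorem card_inversions_le_of_mem_blockPerms {m : ℕ} {w : Equiv.Perm (Fin n)}
    (hw : w ∈ blockPerms n (m + 1)) : (inversions w).card ≤ n * m := by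
  have h0 : n * m = (Finset.range n ×ˢ Finset.range m).card := by simp
  rw [h0]
  refine Finset.card_le_card_of_injOn (fun p => ((p.1 : ℕ), (p.2 : ℕ) - p.1 - 1)) ?_ ?_
  · rintro ⟨a, b⟩ h
    obtain ⟨h1, h2⟩ : a < b ∧ w b < w a := by simpa [inversions] using h
    have e : (a : ℕ) / (m + 1) = b / (m + 1) := by
      refine le_antisymm (Nat.div_le_div_right h1.le) ?_
      rw [← mem_blockPerms.1 hw a, ← mem_blockPerms.1 hw b]
      exact Nat.div_le_div_right h2.le
    have ha := Nat.div_add_mod (a : ℕ) (m + 1)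
    have hb := Nat.div_add_mod (b : ℕ) (m + 1)
    have hb' : (b : ℕ) % (m + 1) < m + 1 := Nat.mod_lt _ (Nat.succ_pos m)
    rw [e] at ha
    have h1' : (a : ℕ) < b := h1
    simp only [Finset.coe_product, Finset.coe_range, Set.mem_prod, Set.mem_Iio]
    omega
  · rintro ⟨a, b⟩ h ⟨a', b'⟩ h' heq
    obtain ⟨h1, -⟩ : a < b ∧ w b < w a := by simpa [inversions] using h
    obtain ⟨h2, -⟩ : a' < b' ∧ w b' < w a' := by simpa [inversions] using h'
    simp only [Prod.mk.injEq] at heq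
    rw [Fin.lt_def] at h1 h2
    simp only [Prod.mk.injEq, Fin.ext_iff]
    omega

/-- The reversal of the block of `a`. -/
def blockReverseFun (n m : ℕ) (a : Fin n) : Fin n :=
  -- First point plus last point of the block, minus `a`; the `min` truncates a last block that may
  -- be incomplete.
  ⟨m * (a / m) + min (m * (a / m) + m) n - 1 - a, by
    have := Nat.mul_div_le (a : ℕ) m
    omega⟩

theorem blockReverseFun_div {m : ℕ} (hm : 0 < m) (a : Fin n) :
    (blockReverseFun n m a : ℕ) / m = a / m := by
  have h1 := Nat.div_add_mod (a : ℕ) m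
  have h2 := Nat.mod_lt (a : ℕ) hm
  have h3 := mul_comm ((a : ℕ) / m) m
  have h4 := a.2
  simp only [blockReverseFun]
  apply Nat.div_eq_of_lt_le
  · rw [h3]; omega
  · rw [Nat.succ_mul, h3]; omega

theorem blockReverseFun_involutive {m : ℕ} (hm : 0 < m) :
    Function.Involutive (blockReverseFun n m) := fun a => by
  have h0 := blockReverseFun_div hm a
  have h1 := Nat.div_add_mod (a : ℕ) m
  have h2 := Nat.mod_lt (a : ℕ) hm
  ext
  rw [blockReverseFun]
  simp only [h0]
  rw [blockReverseFun]
  simp only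
  omega

/-- The permutation reversing every block. -/
def blockReverse (n : ℕ) {m : ℕ} (hm : 0 < m) : Equiv.Perm (Fin n) :=
  (blockReverseFun_involutive hm).toPerm

theorem blockReverse_mem {m : ℕ} (hm : 0 < m) : blockReverse n hm ∈ blockPerms n m :=
  mem_blockPerms.2 fun a => blockReverseFun_div hm a

theorem blockReverse_lt {m : ℕ} (hm : 0 < m) {a b : Fin n} (h : (a : ℕ) / m = b / m) (hab : a < b) :
    blockReverse n hm b < blockReverse n hm a := by
  change blockReverseFun n m b < blockReverseFun n m a
  have h1 := Nat.div_add_mod (a : ℕ) m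
  have h2 := Nat.mod_lt (b : ℕ) hm
  have h3 := Nat.div_add_mod (b : ℕ) m
  rw [Fin.lt_def] at hab ⊢
  simp only [blockReverseFun, h] at h1 ⊢
  omega

/-- If there are at most `k` blocks, all but at most `k` of the generators are a left
descent of `w` or of the product of `w` with the block reversal. -/
theorem le_card_leftDescents_add {m k : ℕ} (hm : 0 < m) (hk : n ≤ k * m) {w : Equiv.Perm (Fin n)}
    (hw : w ∈ blockPerms n m) : n - 1 ≤ (leftDescents (simpleA n) w).card +
      (leftDescents (simpleA n) (w * blockReverse n hm)).card + k := by
  classical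
  -- The generators straddling a block boundary; distinct ones have their lower points in distinct
  -- blocks.
  let J : Finset (Fin (n - 1)) :=
    Finset.univ.filter fun i => ((lo i : Fin n) : ℕ) / m ≠ ((hi i : Fin n) : ℕ) / m
  have hJ : J.card ≤ k := by
    rw [← Finset.card_range k]
    refine Finset.card_le_card_of_injOn (fun i => (i : ℕ) / m) ?_ ?_
    · intro i _
      simp only [Finset.coe_range, Set.mem_Iio]
      exact Nat.div_lt_of_lt_mul (by rw [mul_comm]; omega)
    · have key : ∀ i ∈ J, ∀ j ∈ J, (i : ℕ) < j → (i : ℕ) / m < j / m := by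
        intro i hi' j _ hij
        have h1 : (i : ℕ) / m ≠ (i + 1) / m := (Finset.mem_filter.1 hi').2
        have h2 : (i : ℕ) / m ≤ (i + 1) / m := Nat.div_le_div_right (Nat.le_succ _)
        have h3 : ((i : ℕ) + 1) / m ≤ j / m := Nat.div_le_div_right hij
        omega
      intro i hi' j hj h
      simp only at h
      rcases lt_trichotomy (i : ℕ) j with h1 | h1 | h1
      · have := key i hi' j hj h1; omega
      · exact Fin.ext h1
      · have := key j hj i hi' h1; omega
  have hcover : (Finset.univ : Finset (Fin (n - 1))) ⊆ (leftDescents (simpleA n) w ∪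
      leftDescents (simpleA n) (w * blockReverse n hm)) ∪ J := by
    intro i _
    rw [Finset.mem_union, Finset.mem_union]
    by_cases hJ' : i ∈ J
    · exact Or.inr hJ'
    refine Or.inl ?_
    rw [mem_leftDescents_simpleA, mem_leftDescents_simpleA]
    -- If `i` is not a descent of `w`, the positions of its two values are in increasing order
    -- within one block, and the block reversal turns them around.
    rcases lt_or_gt_of_ne (symm_lo_ne_symm_hi w i) with h | h
    · right
      have hJ'' : ((lo i : Fin n) : ℕ) / m = ((hi i : Fin n) : ℕ) / m := by simpa [J] using hJ'
      exact blockReverse_lt hm (by rw [symm_apply_div hw, symm_apply_div hw, hJ'']) h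
    · exact Or.inl h
  have h1 := Finset.card_le_card hcover
  have h2 := Finset.card_union_le (leftDescents (simpleA n) w ∪
      leftDescents (simpleA n) (w * blockReverse n hm)) J
  have h3 := Finset.card_union_le (leftDescents (simpleA n) w)
      (leftDescents (simpleA n) (w * blockReverse n hm))
  rw [Finset.card_univ, Fintype.card_fin] at h1
  omega

/-- From `d ≥ n / 4` follows `d(d+1)/2 ≥ n²/32`, which already dominates the `n * (n / 32)` possible
inversions; the rank is spare room. -/
theorem isProper_of_mem_blockPerms (hn : 0 < n) {w : Equiv.Perm (Fin n)}
    (hw : w ∈ blockPerms n (n / 32 + 1))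
    (hd : n ≤ 4 * (leftDescents (simpleA n) w).card) : IsProper (simpleA n) w := by
  rw [IsProper, length_simpleA]
  have h1 := card_inversions_le_of_mem_blockPerms hw
  have hdn : (leftDescents (simpleA n) w).card < n := by
    have := Finset.card_le_univ (leftDescents (simpleA n) w)
    rw [Fintype.card_fin] at this
    omega
  have h2 := le_maxw0_simpleA hdn
  generalize (leftDescents (simpleA n) w).card = d at *
  have h3 : n * (n / 32) ≤ (d + 1) * d / 2 := by
    rw [Nat.le_div_iff_mul_le two_pos]
    have h4 : 32 * (n / 32) ≤ n := Nat.mul_div_le n 32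
    nlinarith
  omega

/-- Of `w` and its product with the block reversal, one is proper. If `4 * d ≤ n - 1` for the first,
then the second has `4 * d' ≥ 4 * (n - 33) - (n - 1) = 3 * n - 131`, which is at least `n` as soon
as `n ≥ 66`. -/
theorem card_blockPerms_le (hn : 66 ≤ n) : (blockPerms n (n / 32 + 1)).card ≤
    2 * Nat.card {w : Equiv.Perm (Fin n) // IsProper (simpleA n) w} := by
  classical
  have hm : 0 < n / 32 + 1 := Nat.succ_pos _
  let P : Finset (Equiv.Perm (Fin n)) := Finset.univ.filter fun w => IsProper (simpleA n) w
  have hP : Nat.card {w : Equiv.Perm (Fin n) // IsProper (simpleA n) w} = P.card := by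
    rw [Nat.card_eq_fintype_card, Fintype.card_subtype]
  have hcover : blockPerms n (n / 32 + 1) ⊆
      P ∪ P.image fun w => w * (blockReverse n hm)⁻¹ := by
    intro w hw
    have hw' : w * blockReverse n hm ∈ blockPerms n (n / 32 + 1) := mem_blockPerms.2 fun a => by
      rw [Equiv.Perm.mul_apply, mem_blockPerms.1 hw, mem_blockPerms.1 (blockReverse_mem hm)]
    have hd := le_card_leftDescents_add (k := 32) hm (by omega) hw
    rw [Finset.mem_union, Finset.mem_image]
    by_cases h : n ≤ 4 * (leftDescents (simpleA n) w).card
    · exact Or.inl (Finset.mem_filter.2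
        ⟨Finset.mem_univ _, isProper_of_mem_blockPerms (by omega) hw h⟩)
    · exact Or.inr ⟨_, Finset.mem_filter.2
        ⟨Finset.mem_univ _, isProper_of_mem_blockPerms (by omega) hw' (by omega)⟩,
        mul_inv_cancel_right _ _⟩
  have h1 := Finset.card_le_card hcover
  have h2 := Finset.card_union_le P (P.image fun w => w * (blockReverse n hm)⁻¹)
  have h3 : (P.image fun w => w * (blockReverse n hm)⁻¹).card ≤ P.card := Finset.card_image_le
  omega

theorem pow_le_card_isProper_simpleA (hn : 1 ≤ n) : ((1 / 200 : ℝ) * n) ^ n ≤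
    Nat.card {w : Equiv.Perm (Fin n) // IsProper (simpleA n) w} := by
  -- For small `n` the base `n / 200` is below 1, and the identity alone suffices.
  by_cases hn' : n < 66
  · have h1 : 1 ≤ Nat.card {w : Equiv.Perm (Fin n) // IsProper (simpleA n) w} := by
      have : Nonempty {w : Equiv.Perm (Fin n) // IsProper (simpleA n) w} := ⟨⟨1, isProper_one _⟩⟩
      exact Nat.card_pos
    have h2 : (n : ℝ) < 66 := by exact_mod_cast hn'
    calc ((1 / 200 : ℝ) * n) ^ n ≤ 1 := pow_le_one₀ (by positivity) (by linarith)
      _ ≤ _ := by exact_mod_cast h1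
  · have h1 := factorial_le_card_blockPerms_mul (n := n) (m := n / 32 + 1) (k := 32) (by omega)
    have h2 := card_blockPerms_le (n := n) (by omega)
    generalize Nat.card {w : Equiv.Perm (Fin n) // IsProper (simpleA n) w} = N at *
    have h3 : (n.factorial : ℝ) ≤ 2 * N * 32 ^ n := by
      exact_mod_cast h1.trans (Nat.mul_le_mul_right _ h2)
    -- The term `n ^ n / n!` of the series of `exp n` is at most `exp n ≤ 3 ^ n`.
    have h4 : (n : ℝ) ^ n ≤ 3 ^ n * n.factorial := by
      have h5 := Real.pow_div_factorial_le_exp (n : ℝ) (Nat.cast_nonneg n) n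
      rw [div_le_iff₀ (by positivity), ← Real.exp_one_pow] at h5
      refine h5.trans (mul_le_mul_of_nonneg_right ?_ (Nat.cast_nonneg _))
      exact pow_le_pow_left₀ (Real.exp_pos _).le Real.exp_one_lt_three.le n
    have h6 : (2 : ℝ) ≤ 2 ^ n := by
      simpa using pow_le_pow_right₀ (one_le_two : (1 : ℝ) ≤ 2) hn
    -- The constant is `3 * 32 * 2 = 192`, rounded up: 3 from the factorial, 32 from the blocks, and
    -- 2 absorbing the loss from pairing.
    have h7 : (n : ℝ) ^ n ≤ 200 ^ n * N := by
      calc (n : ℝ) ^ n ≤ 3 ^ n * (2 * N * 32 ^ n) :=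
            h4.trans (mul_le_mul_of_nonneg_left h3 (by positivity))
        _ = 2 * (96 ^ n * N) := by
            rw [show (96 : ℝ) = 3 * 32 by norm_num, mul_pow]; ring
        _ ≤ 2 ^ n * (96 ^ n * N) := mul_le_mul_of_nonneg_right h6 (by positivity)
        _ = 192 ^ n * N := by
            rw [show (192 : ℝ) = 2 * 96 by norm_num, mul_pow]; ring
        _ ≤ 200 ^ n * N := by gcongr; norm_num
    rw [mul_pow, one_div, inv_pow, inv_mul_le_iff₀ (by positivity)]
    exact h7

end Blocks

/-! ### Signed permutations -/

section Signed

variable {n : ℕ}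

instance : Finite (PM n) :=
  Set.Finite.to_subtype ((Set.finite_Icc (-(n : ℤ)) n).subset fun _ hk => abs_le.1 hk.2)

@[simp] theorem PM.idx_pos (i : Fin n) : (PM.pos i).idx = i := by
  ext
  simp only [PM.idx, PM.val_pos]
  omega

@[simp] theorem PM.idx_neg (k : PM n) : (-k).idx = k.idx := by
  ext
  simp only [PM.idx, PM.val_neg, Int.natAbs_neg]

theorem PM.eq_or (k : PM n) : (∃ i, k = pos i) ∨ ∃ i, k = -pos i :=
  k.eq_pos_or_neg.imp (fun h => ⟨_, h.2⟩) fun h => ⟨_, h.2⟩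

theorem SB.ext_pos {v w : SB n} (h : ∀ i, v.1 (PM.pos i) = w.1 (PM.pos i)) : v = w := by
  refine Subtype.ext (Equiv.ext fun k => ?_)
  rcases k.eq_or with ⟨i, rfl⟩ | ⟨i, rfl⟩
  · exact h i
  · rw [v.2, w.2, h]

/-- A permutation of `{1, …, n}` as a map of `[±n]` that commutes with negation. -/
def signedFun (σ : Equiv.Perm (Fin n)) (k : PM n) : PM n :=
  if 0 < k.1 then PM.pos (σ k.idx) else -PM.pos (σ k.idx)

theorem signedFun_pos (σ : Equiv.Perm (Fin n)) (i : Fin n) :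
    signedFun σ (PM.pos i) = PM.pos (σ i) := by
  rw [signedFun, if_pos (by rw [PM.val_pos]; omega), PM.idx_pos]

theorem signedFun_neg_pos (σ : Equiv.Perm (Fin n)) (i : Fin n) :
    signedFun σ (-PM.pos i) = -PM.pos (σ i) := by
  rw [signedFun, if_neg (by rw [PM.val_neg, PM.val_pos]; omega), PM.idx_neg, PM.idx_pos]

theorem signedFun_signedFun (σ τ : Equiv.Perm (Fin n)) (k : PM n) :
    signedFun σ (signedFun τ k) = signedFun (σ * τ) k := by
  rcases k.eq_or with ⟨i, rfl⟩ | ⟨i, rfl⟩ <;>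
    simp only [signedFun_pos, signedFun_neg_pos, Equiv.Perm.mul_apply]

theorem signedFun_one (k : PM n) : signedFun 1 k = k := by
  rcases k.eq_or with ⟨i, rfl⟩ | ⟨i, rfl⟩ <;>
    simp only [signedFun_pos, signedFun_neg_pos, Equiv.Perm.one_apply]

/-- The inclusion of `S_n` into `S_n^B`. -/
def toSB (n : ℕ) : Equiv.Perm (Fin n) →* SB n where
  toFun σ := ⟨⟨signedFun σ, signedFun σ⁻¹,
    fun k => by rw [signedFun_signedFun, inv_mul_cancel, signedFun_one],
    fun k => by rw [signedFun_signedFun, mul_inv_cancel, signedFun_one]⟩, fun k => by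
      rcases k.eq_or with ⟨i, rfl⟩ | ⟨i, rfl⟩ <;>
        simp [signedFun_pos, signedFun_neg_pos]⟩
  map_one' := Subtype.ext (Equiv.ext signedFun_one)
  map_mul' σ τ := Subtype.ext (Equiv.ext fun k => (signedFun_signedFun σ τ k).symm)

theorem toSB_pos (σ : Equiv.Perm (Fin n)) (i : Fin n) :
    (toSB n σ).1 (PM.pos i) = PM.pos (σ i) := signedFun_pos σ i

/-- Since `w` commutes with negation, the absolute value of an image depends only on the absolute
value of the point; this makes forgetting signs multiplicative. -/
theorem idx_apply_pos_idx (w : SB n) (k : PM n) : (w.1 (PM.pos k.idx)).idx = (w.1 k).idx := by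
  rcases k.eq_or with ⟨i, rfl⟩ | ⟨i, rfl⟩ <;> simp [w.2 _]

/-- The map `S_n^B → S_n` that forgets the signs. -/
def forgetSigns (n : ℕ) : SB n →* Equiv.Perm (Fin n) where
  toFun w := ⟨fun i => (w.1 (PM.pos i)).idx, fun i => (w⁻¹.1 (PM.pos i)).idx,
    fun i => (idx_apply_pos_idx w⁻¹ (w.1 (PM.pos i))).trans (by simp), fun i => by simp [idx_apply_pos_idx]⟩
  map_one' := Equiv.ext fun i => PM.idx_pos i
  map_mul' v w := Equiv.ext fun i => (idx_apply_pos_idx v (w.1 (PM.pos i))).symm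

theorem forgetSigns_apply (w : SB n) (i : Fin n) :
    forgetSigns n w i = (w.1 (PM.pos i)).idx := rfl

theorem forgetSigns_toSB (σ : Equiv.Perm (Fin n)) : forgetSigns n (toSB n σ) = σ :=
  Equiv.ext fun i => by rw [forgetSigns_apply, toSB_pos, PM.idx_pos]

/-- The index in types B and D of the generator `s_i` of type A. -/
def succIndex (i : Fin (n - 1)) : Fin n := ⟨i + 1, by omega⟩

theorem succIndex_injective : Function.Injective (succIndex : Fin (n - 1) → Fin n) :=
  fun i j h => by
    have := congrArg Fin.val h
    simp only [succIndex] at this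
    omega

theorem succIndex_ne_zero (i : Fin (n - 1)) : ((succIndex i : Fin n) : ℕ) ≠ 0 :=
  Nat.succ_ne_zero i

theorem toSB_simpleA (i : Fin (n - 1)) :
    toSB n (simpleA n i) = adjacentSwap (succIndex i) (succIndex_ne_zero i) := by
  refine SB.ext_pos fun j => ?_
  have e : (adjacentSwap (succIndex i) (succIndex_ne_zero i)).1 (PM.pos j) =
      Equiv.swap (PM.pos (lo i)) (PM.pos (hi i))
        (Equiv.swap (-PM.pos (lo i)) (-PM.pos (hi i)) (PM.pos j)) := rfl
  rw [toSB_pos, e, Equiv.swap_apply_of_ne_of_ne (PM.pos_ne_neg_pos _ _) (PM.pos_ne_neg_pos _ _),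
    simpleA_eq_swap]
  exact (PM.pos_injective.swap_apply _ _ _).symm

theorem exists_succIndex_eq {i : Fin n} (hi : (i : ℕ) ≠ 0) : ∃ j : Fin (n - 1), succIndex j = i :=
  ⟨⟨i - 1, by omega⟩, Fin.ext (by simp only [succIndex]; omega)⟩

theorem forgetSigns_adjacentSwap {i : Fin n} (hi : (i : ℕ) ≠ 0) :
    ∃ j, forgetSigns n (adjacentSwap i hi) = simpleA n j := by
  obtain ⟨j, rfl⟩ := exists_succIndex_eq hi
  exact ⟨j, by rw [← toSB_simpleA, forgetSigns_toSB]⟩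

theorem forgetSigns_negSwap (i : Fin n) : forgetSigns n (negSwap (PM.pos i)) = 1 := by
  ext j
  rw [forgetSigns_apply]
  change ((Equiv.swap (PM.pos i) (-PM.pos i) (PM.pos j)).idx : ℕ) = j
  rw [Equiv.swap_apply_def]
  split_ifs with h1 h2
  · rw [PM.idx_neg, PM.idx_pos, PM.pos_injective h1]
  · exact absurd h2 (PM.pos_ne_neg_pos _ _)
  · rw [PM.idx_pos]

theorem forgetSigns_twistedSwap (hn : 2 ≤ n) :
    forgetSigns n (twistedSwap n hn) = simpleA n ⟨0, by omega⟩ := by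
  ext j
  rw [forgetSigns_apply]
  have e : (twistedSwap n hn).1 (PM.pos j) =
      Equiv.swap (PM.pos ⟨0, by omega⟩) (-PM.pos ⟨1, by omega⟩)
        (Equiv.swap (-PM.pos ⟨0, by omega⟩) (- -PM.pos ⟨1, by omega⟩) (PM.pos j)) := rfl
  rw [e, simpleA, neg_neg]
  simp only [Equiv.swap_apply_def, PM.ext_iff, PM.val_neg, PM.val_pos, Fin.ext_iff, PM.idx]
  split_ifs <;> simp_all <;> omega

theorem toSB_mem_SD (σ : Equiv.Perm (Fin n)) : toSB n σ ∈ SD n := by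
  have h : negCount (toSB n σ) = 0 := by
    rw [negCount, Finset.card_eq_zero, Finset.filter_eq_empty_iff]
    intro j _
    rw [toSB_pos, PM.val_pos]
    omega
  change Even _
  rw [h]
  exact Even.zero

/-- Forgetting signs kills the sign change `s_0` and sends each other generator to its adjacent
transposition. -/
theorem card_isProper_simpleA_le_simpleB (n : ℕ) :
    Nat.card {w : Equiv.Perm (Fin n) // IsProper (simpleA n) w} ≤
      Nat.card {w : SB n // IsProper (simpleB n) w} := by
  refine card_isProper_le_of_retraction succIndex_injective (φ := toSB n) (π := forgetSigns n)
    (fun i => ?_) (fun j => ?_) forgetSigns_toSB simpleA_generates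
  · rw [toSB_simpleA, simpleB, dif_neg (succIndex_ne_zero i)]
  · rw [simpleB]
    split_ifs with h
    · exact Or.inl (forgetSigns_negSwap j)
    · exact Or.inr (forgetSigns_adjacentSwap h)

/-- Here no generator is killed: the twisted one and `s_1` both become the transposition of the
first two points. -/
theorem card_isProper_simpleA_le_simpleD (n : ℕ) (hn : 2 ≤ n) :
    Nat.card {w : Equiv.Perm (Fin n) // IsProper (simpleA n) w} ≤
      Nat.card {w : SD n // IsProper (simpleD n hn) w} := by
  refine card_isProper_le_of_retraction succIndex_injective
    (φ := (toSB n).codRestrict (SD n) toSB_mem_SD) (π := (forgetSigns n).comp (SD n).subtype)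
    (fun i => ?_) (fun j => ?_) forgetSigns_toSB simpleA_generates
  · refine Subtype.ext ?_
    rw [simpleD, dif_neg (succIndex_ne_zero i)]
    exact toSB_simpleA i
  · rw [simpleD]
    split_ifs with h
    · exact Or.inr ⟨_, forgetSigns_twistedSwap hn⟩
    · exact Or.inr (forgetSigns_adjacentSwap h)

end Signed
end ProperElements

theorem theorem6p2 :
    ∃ c : ℝ, 0 < c ∧
      (∀ n : ℕ, 1 ≤ n →
        (c * n) ^ n ≤ (Nat.card {w : Equiv.Perm (Fin n) //
          ProperElements.IsProper (ProperElements.simpleA n) w} : ℝ)) ∧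
      (∀ (n : ℕ) (hn : 2 ≤ n),
        (c * n) ^ n ≤ (Nat.card {w : ProperElements.SD n //
          ProperElements.IsProper (ProperElements.simpleD n hn) w} : ℝ)) ∧
      (∀ n : ℕ, 1 ≤ n →
        (c * n) ^ n ≤ (Nat.card {w : ProperElements.SB n //
          ProperElements.IsProper (ProperElements.simpleB n) w} : ℝ)) := by
  refine ⟨1 / 200, by norm_num, fun n hn => ProperElements.pow_le_card_isProper_simpleA hn,
    fun n hn => (ProperElements.pow_le_card_isProper_simpleA (by omega)).trans ?_,
    fun n hn => (ProperElements.pow_le_card_isProper_simpleA hn).trans ?_⟩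
  · exact_mod_cast ProperElements.card_isProper_simpleA_le_simpleD n hn
  · exact_mod_cast ProperElements.card_isProper_simpleA_le_simpleB n
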